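/- Let $\theta^*\in\mathbb{R}$ and $c>0$, and consider the Dirichlet process mixture model $$X_i\mid\theta_i\overset{ind}{\sim}k(\cdot\mid\theta_i),\qquad \theta_i\mid\tilde P\overset{iid}{\sim}\tilde P,\qquad \tilde P\mid\alpha\sim \mathrm{DP}(\alpha,Q_0),\qquad \alpha\sim\pi,$$ where $k(\cdot\mid\theta)$ is the density of $\mathrm{Unif}(\theta-c,\theta+c)$, $Q_0=\mathrm{Unif}(\theta^*-c,\theta^*+c)$ with density $q_0$, and $\pi$ is a probability distribution on $(0,\infty)$. Let $K_n$ be the number of clusters among the first $n$ observations. Expressed through random partitions, the model gives the joint density $$\mathrm{pr}(X_{1:n}=x_{1:n},K_n=s)=\sum_{A\in\tau_s(n)}\left(\int\frac{\alpha^s}{\alpha(\alpha+1)\cdots(\alpha+n-1)}\,\pi(d\alpha)\prod_{j=1}^s(|A_j|-1)!\right)\prod_{j=1}^s m(x_{A_j}),$$ $$m(x_{A_j})=\int\prod_{i\in A_j}k(x_i\mid\theta)\,q_0(\theta)\,d\theta,$$ where $\tau_s(n)$ is the set of partitions $A=\{A_1,\dots,A_s\}$ of $\{1,\dots,n\}$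 into $s$ non-empty subsets, and the posterior distribution of the number of clusters is $$\mathrm{pr}(K_n=s\mid X_{1:n})=\frac{\mathrm{pr}(X_{1:n},K_n=s)}{\sum_{r=1}^n\mathrm{pr}(X_{1:n},K_n=r)}.$$ Suppose that (A1) $\pi$ is absolutely continuous with respect to the Lebesgue measure, with density also denoted by $\pi$; (A2) there are $\epsilon>0$, $\delta>0$ and $\beta\in\mathbb{R}$ such that $\frac1\delta\alpha^\beta\le\pi(\alpha)\le\delta\alpha^\beta$ for (almost) every $\alpha\in(0,\epsilon)$; (A3) there are $D,\nu>0$ and $\rho\ge 38$ such that $\int\alpha^s\pi(\alpha)\,d\alpha<D\rho^{-s}\,\Gamma(\nu+s+1)$ for every integer $s\ge1$. If the data $X_1,X_2,\dots$ are in fact independent and identically distributed with distribution $\mathrm{Unif}(\theta^*-c,\theta^*+c)$, and $P^{(\infty)}$ denotes their joint law, then $$\mathrm{pr}(K_n=1\mid X_{1:n})\to1\qquad\text{in }P^{(\infty)}\text{-probability as }n\to\infty.$$ -/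

import Mathlib

open MeasureTheory ProbabilityTheory Filter Set
open scoped Nat

noncomputable section

namespace DPMixture

/-! ### Dirichlet process mixtures in terms of random partitions

The mixture model is `X_i | θ_i ~ k(· | θ_i)`, `θ_i | P ~ P` i.i.d., `P | α ~ DP(α, Q₀)`, `α ~ π`,
on the real line, where `Q₀` has Lebesgue density `q₀`. Partitions of `{1, …, n}` into non-empty
sets are the terms of type `Finpartition (Finset.univ : Finset (Fin n))`. -/

/-- The set `τ_s(n)` of partitions of an `n`-element set into `s` non-empty subsets. -/
def partitionsInto (n s : ℕ) : Finset (Finpartition (Finset.univ : Finset (Fin n))) :=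
  Finset.univ.filter fun A => A.parts.card = s

/-- The ascending factorial `α (α + 1) ⋯ (α + n - 1)`. -/
def ascFactorial (α : ℝ) (n : ℕ) : ℝ := ∏ i ∈ Finset.range n, (α + i)

/-- The conditional prior probability `pr(A | α) = α ^ s / α^{(n)} * ∏_j (a_j - 1)!` of the
partition `A = {A_1, …, A_s}` with block sizes `a_j ≥ 1`, given the concentration parameter. -/
def partitionProbGiven {n : ℕ} (α : ℝ) (A : Finpartition (Finset.univ : Finset (Fin n))) : ℝ :=
  α ^ A.parts.card / ascFactorial α n * ∏ B ∈ A.parts, ((B.card - 1)! : ℝ)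

/-- The prior probability `pr(A) = ∫ pr(A | α) π(dα)`. -/
def partitionProb {n : ℕ} (π : Measure ℝ) (A : Finpartition (Finset.univ : Finset (Fin n))) : ℝ :=
  ∫ α, partitionProbGiven α A ∂π

/-- The marginal likelihood `m(x_B) = ∫ ∏_{i ∈ B} k(x_i | θ) q₀(θ) dθ` of the observations with
index in the block `B`; the kernel is written `k x θ = k(x | θ)`. -/
def marginalLikelihood {n : ℕ} (k : ℝ → ℝ → ℝ) (q₀ : ℝ → ℝ) (x : Fin n → ℝ)
    (B : Finset (Fin n)) : ℝ :=
  ∫ θ, (∏ i ∈ B, k (x i) θ) * q₀ θ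

/-- The joint density `pr(X_{1:n} = x_{1:n}, K_n = s) = ∑_{A ∈ τ_s(n)} pr(A) ∏_j m(x_{A_j})` of the
data and the number of clusters. -/
def jointDensity {n : ℕ} (k : ℝ → ℝ → ℝ) (q₀ : ℝ → ℝ) (π : Measure ℝ) (x : Fin n → ℝ)
    (s : ℕ) : ℝ :=
  ∑ A ∈ partitionsInto n s, partitionProb π A * ∏ B ∈ A.parts, marginalLikelihood k q₀ x B

/-- The posterior probability `pr(K_n = s | X_{1:n} = x_{1:n})` of having `s` clusters. -/
def posteriorClusters {n : ℕ} (k : ℝ → ℝ → ℝ) (q₀ : ℝ → ℝ) (π : Measure ℝ) (x : Fin n → ℝ)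
    (s : ℕ) : ℝ :=
  jointDensity k q₀ π x s / ∑ r ∈ Finset.range (n + 1), jointDensity k q₀ π x r

/-! ### Assumptions on the prior of the concentration parameter -/

/-- Polynomial behaviour of the Lebesgue density of `π` around the origin. The bounds are required
almost everywhere, since the density is only defined up to null sets. -/
def PolynomialAtOrigin (π : Measure ℝ) : Prop :=
  ∃ ε δ β : ℝ, 0 < ε ∧ 0 < δ ∧ ∀ᵐ α : ℝ, α ∈ Ioo 0 ε →
    1 / δ * α ^ β ≤ (π.rnDeriv volume α).toReal ∧ (π.rnDeriv volume α).toReal ≤ δ * α ^ β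

/-- Subfactorial moments with parameter `ρ`. The moments are `ℝ≥0∞`-valued integrals, so the bound
contains their finiteness. -/
def SubfactorialMoments (π : Measure ℝ) (ρ : ℝ) : Prop :=
  ∃ D ν : ℝ, 0 < D ∧ 0 < ν ∧ ∀ s : ℕ, 1 ≤ s →
    ∫⁻ α, ENNReal.ofReal (α ^ s) ∂π < ENNReal.ofReal (D * (ρ ^ s)⁻¹ * Real.Gamma (ν + s + 1))

/-! ### The uniform kernel -/

/-- The density at `x` of the uniform distribution on `(θ - c, θ + c)`. -/
def unifDensity (c θ x : ℝ) : ℝ :=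
  (pdf.uniformPDF (Ioo (θ - c) (θ + c)) x).toReal

end DPMixture

end

/-! Write n = m + 1. The kernel and the true law share the scale c, so a single cluster explains the
data almost as well as possible. With high probability every observation stays at distance c ε / n
from the end points, and then the one-block likelihood is at least (2c)⁻ⁿ ε / n
(`le_marginalLikelihood`).

The terms with several clusters are bounded in expectation. Disjoint blocks are independent, and a
block of size a has expected likelihood at most (2c)⁻ᵃ · 2 / (a + 1), because a random θ loses
overlap with the data interval (`lintegral_marginalLikelihood_le`). Together with the prior factor
(a - 1)! this gives the weight 2 a! / a² per block. Summed over all partitions into s blocks, the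
weights contribute at most 16ˢ n! / (s! n²) (`partitionSum_le`). Since n! / n² = (n - 1)! / n, this
matches the size of the one-cluster term up to 16ˢ / s! and ε.

By Markov's inequality it remains to compare prior moments. The weights 1 / ((α + 1) ⋯ (α + m)),
once normalized, concentrate the prior at α = 0. The sum over s ≥ 2 is dominated by 256 α e^{16α},
which vanishes at 0 and is integrable by the moment assumption, so the ratio tends to 0
(`tendsto_sum_priorMoment_div`). -/

namespace DPMixture

/-! ### Weighted sums over set partitions -/

section Partitions

variable {ι : Type*} [DecidableEq ι]

/-- The sum, over the partitions of `S` into `s` blocks, of the product of the weights of the block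
sizes. -/
def partitionSum (w : ℕ → ℝ) (S : Finset ι) (s : ℕ) : ℝ :=
  ∑ A : Finpartition S with A.parts.card = s, ∏ B ∈ A.parts, w B.card

theorem avoid_parts_eq_erase {S : Finset ι} (A : Finpartition S) {B : Finset ι}
    (hB : B ∈ A.parts) : (A.avoid B).parts = A.parts.erase B := by
  ext C
  rw [Finpartition.mem_avoid, Finset.mem_erase]
  constructor
  · rintro ⟨D, hD, hDB, rfl⟩
    have hne : D ≠ B := fun h => hDB h.le
    have hd : Disjoint D B := A.disjoint hD hB hne
    rw [Finset.sdiff_eq_self_of_disjoint hd]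
    exact ⟨hne, hD⟩
  · rintro ⟨hne, hC⟩
    have hd : Disjoint C B := A.disjoint hC hB hne
    refine ⟨C, hC, fun h => A.ne_bot hC (hd.eq_bot_of_le h), Finset.sdiff_eq_self_of_disjoint hd⟩

/-- Double counting of pairs (partition, distinguished block): a partition has s + 1 choices of
block, and deleting the block B injects into the partitions of `S \ B`. Surjectivity is not needed
for an upper bound. -/
theorem succ_mul_partitionSum_le {w : ℕ → ℝ} (hw : ∀ a, 0 ≤ w a) (S : Finset ι) (s : ℕ) :
    (s + 1) * partitionSum w S (s + 1) ≤
      ∑ B ∈ S.powerset.erase ∅, w B.card * partitionSum w (S \ B) s := by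
  unfold partitionSum
  have h1 : ((s : ℝ) + 1) * ∑ A : Finpartition S with A.parts.card = s + 1,
      ∏ B ∈ A.parts, w B.card = ∑ A : Finpartition S with A.parts.card = s + 1,
        ∑ B ∈ A.parts, w B.card * ∏ C ∈ A.parts.erase B, w C.card := by
    rw [Finset.mul_sum]
    refine Finset.sum_congr rfl fun A hA => ?_
    have hc : A.parts.card = s + 1 := (Finset.mem_filter.1 hA).2
    rw [Finset.sum_congr rfl fun B hB => Finset.mul_prod_erase A.parts (fun C => w C.card) hB]
    rw [Finset.sum_const, hc, nsmul_eq_mul]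
    push_cast
    ring
  rw [h1, Finset.sum_comm' (s' := fun B => Finset.univ.filter fun A : Finpartition S =>
    A.parts.card = s + 1 ∧ B ∈ A.parts) (t' := S.powerset.erase ∅)]
  · refine Finset.sum_le_sum fun B _ => ?_
    rw [← Finset.mul_sum]
    refine mul_le_mul_of_nonneg_left ?_ (hw _)
    have hinj : Set.InjOn (fun A : Finpartition S => A.avoid B)
        (Finset.univ.filter fun A : Finpartition S => A.parts.card = s + 1 ∧ B ∈ A.parts) := by
      intro A hA A' hA' h
      simp only [Finset.coe_filter, Finset.mem_univ, true_and, Set.mem_ofPred_eq] at hA hA'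
      have h2 := congrArg Finpartition.parts h
      simp only [avoid_parts_eq_erase A hA.2, avoid_parts_eq_erase A' hA'.2] at h2
      refine Finpartition.ext ?_
      rw [← Finset.insert_erase hA.2, ← Finset.insert_erase hA'.2, h2]
    rw [Finset.sum_congr rfl (g := fun A : Finpartition S =>
      (fun A' : Finpartition (S \ B) => ∏ C ∈ A'.parts, w C.card) (A.avoid B)),
      ← Finset.sum_image (f := fun A' : Finpartition (S \ B) => ∏ C ∈ A'.parts, w C.card) hinj]
    · refine Finset.sum_le_sum_of_subset_of_nonneg ?_
        fun A _ _ => Finset.prod_nonneg fun _ _ => hw _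
      intro A' hA'
      obtain ⟨A, hA, rfl⟩ := Finset.mem_image.1 hA'
      obtain ⟨-, hc, hB⟩ := Finset.mem_filter.1 hA
      simp [avoid_parts_eq_erase A hB, Finset.card_erase_of_mem hB, hc]
    · intro A hA
      obtain ⟨-, hc, hB⟩ := Finset.mem_filter.1 hA
      simp only [avoid_parts_eq_erase A hB]
  · intro A B
    simp only [Finset.mem_filter, Finset.mem_univ, true_and, Finset.mem_erase, Finset.mem_powerset]
    constructor
    · rintro ⟨h, hB⟩
      exact ⟨⟨h, hB⟩, A.ne_bot hB, A.le hB⟩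
    · rintro ⟨h, -⟩
      exact h

theorem partitionSum_zero_of_nonempty (w : ℕ → ℝ) {S : Finset ι} (hS : S.Nonempty) :
    partitionSum w S 0 = 0 := by
  unfold partitionSum
  rw [Finset.filter_false_of_mem, Finset.sum_empty]
  intro A _ h
  have := A.sup_parts
  rw [Finset.card_eq_zero.1 h] at this
  exact hS.ne_empty (by simpa using this.symm)

theorem partitionSum_empty_succ (w : ℕ → ℝ) (s : ℕ) :
    partitionSum w (∅ : Finset ι) (s + 1) = 0 := by
  unfold partitionSum
  rw [Finset.filter_false_of_mem, Finset.sum_empty]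
  intro A _ h
  have h2 : A.parts = ∅ := by
    refine Finset.eq_empty_of_forall_notMem fun B hB => A.ne_bot hB ?_
    exact le_bot_iff.1 (A.le hB)
  simp [h2] at h

theorem partitionSum_empty_zero_le (w : ℕ → ℝ) :
    partitionSum w (∅ : Finset ι) 0 ≤ 1 := by
  unfold partitionSum
  have : ∀ A ∈ (Finset.univ.filter fun A : Finpartition (∅ : Finset ι) => A.parts.card = 0),
      ∏ B ∈ A.parts, w B.card = 1 := by
    intro A hA
    rw [Finset.card_eq_zero.1 (Finset.mem_filter.1 hA).2, Finset.prod_empty]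
  rw [Finset.sum_congr rfl this, Finset.sum_const, nsmul_eq_mul, mul_one]
  have h1 : (Finset.univ.filter fun A : Finpartition (∅ : Finset ι) => A.parts.card = 0).card ≤ 1 :=
    Finset.card_le_one.2 fun A hA A' hA' => Finpartition.ext <| by
      rw [Finset.card_eq_zero.1 (Finset.mem_filter.1 hA).2,
        Finset.card_eq_zero.1 (Finset.mem_filter.1 hA').2]
  exact_mod_cast h1

/-! ### Convolution of inverse squares. -/

theorem sum_range_inv_sq_le_two (n : ℕ) : ∑ a ∈ Finset.range (n + 1), ((a : ℝ) ^ 2)⁻¹ ≤ 2 := by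
  have h : ∀ n : ℕ, ∑ a ∈ Finset.range (n + 2), ((a : ℝ) ^ 2)⁻¹ ≤ 2 - 1 / (n + 1) := by
    intro n
    induction n with
    | zero => norm_num [Finset.sum_range_succ]
    | succ k ih =>
      rw [Finset.sum_range_succ]
      have : ((((k + 2 : ℕ) : ℝ)) ^ 2)⁻¹ ≤ 1 / ((k : ℝ) + 1) - 1 / (k + 1 + 1) := by
        have hk : (0 : ℝ) ≤ k := k.cast_nonneg
        rw [div_sub_div _ _ (by positivity) (by positivity), inv_eq_one_div,
          div_le_div_iff₀ (by positivity) (by positivity)]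
        push_cast
        nlinarith
      push_cast at this ⊢
      linarith
  calc _ ≤ ∑ a ∈ Finset.range (n + 2), ((a : ℝ) ^ 2)⁻¹ := by
        rw [Finset.sum_range_succ _ (n + 1)]
        exact le_add_of_nonneg_right (by positivity)
    _ ≤ 2 := (h n).trans (sub_le_self _ (by positivity))

/-- Inverse squares are stable under convolution up to a constant: (x + y)² ≤ 2 (x² + y²) separates
the product into two sums, each at most 2. -/
theorem sum_range_inv_sq_mul_inv_sq_le {n : ℕ} (hn : 0 < n) :
    ∑ a ∈ Finset.range (n + 1), ((a : ℝ) ^ 2)⁻¹ * (((n - a : ℕ) : ℝ) ^ 2)⁻¹ ≤ 8 / (n : ℝ) ^ 2 := by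
  have hn' : (0 : ℝ) < n := by exact_mod_cast hn
  have h1 : ∀ a ∈ Finset.range (n + 1), ((a : ℝ) ^ 2)⁻¹ * (((n - a : ℕ) : ℝ) ^ 2)⁻¹ ≤
      2 / (n : ℝ) ^ 2 * (((a : ℝ) ^ 2)⁻¹ + (((n - a : ℕ) : ℝ) ^ 2)⁻¹) := by
    intro a ha
    have han : a ≤ n := by simpa [Nat.lt_succ_iff] using ha
    -- The extreme terms vanish because the inverse of 0 is 0.
    rcases Nat.eq_zero_or_pos a with rfl | h0
    · simp; positivity
    rcases Nat.eq_zero_or_pos (n - a) with h2 | h2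
    · rw [h2]; simp; positivity
    have hx : (0 : ℝ) < a := by exact_mod_cast h0
    have hy : (0 : ℝ) < (n - a : ℕ) := by exact_mod_cast h2
    have hs : (n : ℝ) = a + (n - a : ℕ) := by exact_mod_cast (by omega : n = a + (n - a))
    rw [hs]
    generalize ((n - a : ℕ) : ℝ) = y at hy
    generalize (a : ℝ) = x at hx
    have : 2 / (x + y) ^ 2 * ((x ^ 2)⁻¹ + (y ^ 2)⁻¹) - (x ^ 2)⁻¹ * (y ^ 2)⁻¹ =
        (x - y) ^ 2 / ((x + y) ^ 2 * x ^ 2 * y ^ 2) := by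
      field_simp
      ring
    have h3 : 0 ≤ (x - y) ^ 2 / ((x + y) ^ 2 * x ^ 2 * y ^ 2) := by positivity
    linarith
  refine (Finset.sum_le_sum h1).trans ?_
  rw [← Finset.mul_sum, Finset.sum_add_distrib]
  have h2 : ∑ a ∈ Finset.range (n + 1), (((n - a : ℕ) : ℝ) ^ 2)⁻¹ =
      ∑ a ∈ Finset.range (n + 1), ((a : ℝ) ^ 2)⁻¹ := by
    rw [← Finset.sum_range_reflect]
    refine Finset.sum_congr rfl fun a ha => ?_
    have han : a ≤ n := by simpa [Nat.lt_succ_iff] using ha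
    congr 4
    omega
  rw [h2]
  have h3 := sum_range_inv_sq_le_two n
  calc _ ≤ 2 / (n : ℝ) ^ 2 * (2 + 2) := by gcongr
    _ = _ := by ring

/-- The bound for the contribution of a block of size `a` in an `n`-element set, given the bound of
`partitionSum_le` for the partitions of the other elements into `s + 1` blocks. -/
noncomputable def sizeBound (s n a : ℕ) : ℝ :=
  2 * a ! * ((a : ℝ) ^ 2)⁻¹ * (16 ^ (s + 1) * (n - a)! / ((s + 1)! * ((n - a : ℕ) : ℝ) ^ 2))

theorem sizeBound_nonneg (s n a : ℕ) : 0 ≤ sizeBound s n a := by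
  unfold sizeBound
  positivity

/-- The binomial coefficient turns a! (n - a)! into n!, so only the convolution of inverse squares
remains. -/
theorem sum_choose_smul_sizeBound_le (s : ℕ) {n : ℕ} (hn : 0 < n) :
    ∑ a ∈ Finset.range (n + 1), n.choose a • sizeBound s n a ≤
      2 * 16 ^ (s + 1) * n ! / (s + 1)! * (8 / (n : ℝ) ^ 2) := by
  refine le_trans (le_of_eq ?_)
    (mul_le_mul_of_nonneg_left (sum_range_inv_sq_mul_inv_sq_le hn) (by positivity))
  rw [Finset.mul_sum]
  refine Finset.sum_congr rfl fun a ha => ?_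
  have han : a ≤ n := by simpa [Nat.lt_succ_iff] using ha
  have hc : (n ! : ℝ) = n.choose a * a ! * (n - a)! := by
    exact_mod_cast (Nat.choose_mul_factorial_mul_factorial han).symm
  rw [nsmul_eq_mul, hc, sizeBound]
  simp only [div_eq_mul_inv, mul_inv]
  ring

/-- If the weight of a block of size `a` is at most `2 a! / a ^ 2`, the sum over the partitions of
an `n`-element set into `s` blocks is at most `16 ^ s n! / (s! n ^ 2)`. -/
theorem partitionSum_le {w : ℕ → ℝ} (hw : ∀ a, 0 ≤ w a)
    (hw' : ∀ a, 0 < a → w a ≤ 2 * a ! * ((a : ℝ) ^ 2)⁻¹) (s : ℕ) (S : Finset ι)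
    (hS : S.Nonempty) :
    partitionSum w S (s + 1) ≤ 16 ^ (s + 1) * S.card ! / ((s + 1)! * (S.card : ℝ) ^ 2) := by
  induction s generalizing S with
  | zero =>
    have h := succ_mul_partitionSum_le hw S 0
    have hSc : 0 < S.card := hS.card_pos
    have hSc' : (0 : ℝ) < S.card := by exact_mod_cast hSc
    -- With one block, the distinguished block must be all of `S`.
    rw [Finset.sum_eq_single S] at h
    · simp only [Nat.cast_zero, zero_add, one_mul, Finset.sdiff_self] at h
      calc _ ≤ w S.card * 1 :=
            h.trans (mul_le_mul_of_nonneg_left (partitionSum_empty_zero_le w) (hw _))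
        _ ≤ 2 * S.card ! * ((S.card : ℝ) ^ 2)⁻¹ := by rw [mul_one]; exact hw' _ hSc
        _ ≤ 16 * S.card ! * ((S.card : ℝ) ^ 2)⁻¹ := by gcongr; norm_num
        _ = _ := by simp [div_eq_mul_inv]
    · intro B hB hne
      have hBS : B ⊆ S := Finset.mem_powerset.1 (Finset.mem_of_mem_erase hB)
      rw [partitionSum_zero_of_nonempty, mul_zero]
      exact Finset.sdiff_nonempty.2 fun h => hne (hBS.antisymm h)
    · intro h2
      exact absurd (Finset.mem_erase.2 ⟨hS.ne_empty, Finset.mem_powerset_self S⟩) h2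
  | succ s ih =>
    have h := succ_mul_partitionSum_le hw S (s + 1)
    have h1 : ∑ B ∈ S.powerset.erase ∅, w B.card * partitionSum w (S \ B) (s + 1) ≤
        ∑ B ∈ S.powerset, sizeBound s S.card B.card := by
      have h4 : ∑ B ∈ S.powerset.erase ∅, sizeBound s S.card B.card ≤
          ∑ B ∈ S.powerset, sizeBound s S.card B.card :=
        Finset.sum_le_sum_of_subset_of_nonneg (Finset.erase_subset ∅ S.powerset)
          fun _ _ _ => sizeBound_nonneg _ _ _
      refine le_trans (Finset.sum_le_sum fun B hB => ?_) h4
      obtain ⟨hne, hBS⟩ := Finset.mem_erase.1 hB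
      rw [Finset.mem_powerset] at hBS
      -- The induction hypothesis needs a non-empty complement; an empty one has no partition into s
      -- + 1 ≥ 1 blocks.
      by_cases hBe : S \ B = ∅
      · rw [hBe, partitionSum_empty_succ, mul_zero]
        exact sizeBound_nonneg _ _ _
      · have h2 := ih (S \ B) (Finset.nonempty_iff_ne_empty.2 hBe)
        rw [Finset.card_sdiff_of_subset hBS] at h2
        have h3 := hw' B.card (Finset.card_pos.2 (Finset.nonempty_iff_ne_empty.2 hne))
        have h5 : (0 : ℝ) ≤ 16 ^ (s + 1) * (S.card - B.card)! /
          ((s + 1)! * ((S.card - B.card : ℕ) : ℝ) ^ 2) := by positivity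
        exact (mul_le_mul_of_nonneg_left h2 (hw _)).trans (mul_le_mul_of_nonneg_right h3 h5)
    rw [Finset.sum_powerset_apply_card] at h1
    -- The constant 16 reproduces itself: 2 from the block weight times 8 from the convolution. The
    -- new factor 1 / (s + 2) completes the factorial.
    have h3 := h.trans (h1.trans (sum_choose_smul_sizeBound_le s hS.card_pos))
    rw [mul_comm, ← le_div_iff₀ (by positivity)] at h3
    refine h3.trans (le_of_eq ?_)
    generalize S.card = n
    rw [Nat.factorial_succ (s + 1), pow_succ (16 : ℝ) (s + 1)]
    have : (((s + 1)! : ℕ) : ℝ) ≠ 0 := by positivity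
    push_cast
    generalize (((s + 1)! : ℕ) : ℝ) = t at this
    generalize (16 : ℝ) ^ (s + 1) = u
    have : (s : ℝ) + 1 + 1 ≠ 0 := by positivity
    field_simp
    ring

end Partitions

end DPMixture

namespace DPMixture

/-! ### The prior of the concentration parameter -/

section Prior

/-- The product of `1 / (α + i)` over `1 ≤ i ≤ m`. -/
noncomputable def ascWeight (m : ℕ) (α : ℝ) : ℝ := (∏ i ∈ Finset.range m, (α + (i + 1)))⁻¹

theorem pow_div_ascFactorial {α : ℝ} (hα : 0 < α) (m s : ℕ) :
    α ^ (s + 1) / ascFactorial α (m + 1) = α ^ s * ascWeight m α := by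
  unfold ascFactorial ascWeight
  rw [Finset.prod_range_succ', Nat.cast_zero, add_zero, pow_succ, mul_div_mul_right _ _ hα.ne',
    div_eq_mul_inv]
  push_cast
  rfl

theorem ascWeight_pos (m : ℕ) {α : ℝ} (hα : 0 ≤ α) : 0 < ascWeight m α :=
  inv_pos.2 (Finset.prod_pos fun i _ => by positivity)

theorem ascWeight_antitone (m : ℕ) {α β : ℝ} (hα : 0 ≤ α) (h : α ≤ β) :
    ascWeight m β ≤ ascWeight m α := by
  unfold ascWeight
  refine inv_anti₀ (Finset.prod_pos fun i _ => by positivity) ?_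
  exact Finset.prod_le_prod (fun i _ => by positivity) fun i _ => by linarith

theorem ascWeight_le_one (m : ℕ) {α : ℝ} (hα : 0 ≤ α) : ascWeight m α ≤ 1 := by
  unfold ascWeight
  refine inv_le_one_of_one_le₀ ?_
  calc (1 : ℝ) = ∏ _i ∈ Finset.range m, 1 := Finset.prod_const_one.symm
    _ ≤ _ := Finset.prod_le_prod (fun _ _ => zero_le_one) fun i _ => by
      have : (0 : ℝ) ≤ i := i.cast_nonneg
      linarith

theorem measurable_ascWeight (m : ℕ) : Measurable (ascWeight m) := by
  unfold ascWeight
  fun_prop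

/-- The inverse ratio is ∏ (1 + (b - a) / (a + i + 1)), which exceeds the sum of its increments and
so diverges with the harmonic series, as a + i + 1 ≤ (a + 1)(i + 1). -/
theorem tendsto_ascWeight_div {a b : ℝ} (ha : 0 ≤ a) (hab : a < b) :
    Tendsto (fun m => ascWeight m b / ascWeight m a) atTop (nhds 0) := by
  have hkey : ∀ m : ℕ, (b - a) / (a + 1) * ∑ i ∈ Finset.range m, (1 / (i + 1) : ℝ) ≤
      ascWeight m a / ascWeight m b := by
    intro m
    have h1 : ascWeight m a / ascWeight m b =
        ∏ i ∈ Finset.range m, (1 + (b - a) / (a + (i + 1))) := by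
      unfold ascWeight
      rw [inv_div_inv, ← Finset.prod_div_distrib]
      refine Finset.prod_congr rfl fun i _ => ?_
      have : a + ((i : ℝ) + 1) ≠ 0 := by positivity
      field_simp
      ring
    have h2 : ∀ (f : ℕ → ℝ), (∀ i, 0 ≤ f i) → ∀ m : ℕ, ∑ i ∈ Finset.range m, f i ≤
        ∏ i ∈ Finset.range m, (1 + f i) := by
      intro f hf m
      have : 1 + ∑ i ∈ Finset.range m, f i ≤ ∏ i ∈ Finset.range m, (1 + f i) := by
        induction m with
        | zero => simp
        | succ k ih =>
          rw [Finset.sum_range_succ, Finset.prod_range_succ]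
          have h3 : 0 ≤ ∑ i ∈ Finset.range k, f i := Finset.sum_nonneg fun i _ => hf i
          nlinarith [hf k, mul_nonneg h3 (hf k)]
      linarith
    rw [h1]
    refine le_trans ?_ (h2 _ (fun i => div_nonneg (by linarith) (by positivity)) m)
    rw [Finset.mul_sum]
    refine Finset.sum_le_sum fun i _ => ?_
    rw [div_mul_div_comm, mul_one]
    refine div_le_div_of_nonneg_left (by linarith) (by positivity) ?_
    have : (0 : ℝ) ≤ i := i.cast_nonneg
    nlinarith [mul_nonneg ha this]
  have h3 : Tendsto (fun m => ascWeight m a / ascWeight m b) atTop atTop := by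
    refine tendsto_atTop_mono hkey ?_
    exact Real.tendsto_sum_range_one_div_nat_succ_atTop.const_mul_atTop
      (div_pos (by linarith) (by linarith))
  refine h3.inv_tendsto_atTop.congr fun m => ?_
  simp [inv_div]

/-- The prior charges every neighbourhood of the origin: otherwise its density would vanish almost
everywhere there, against the lower polynomial bound. -/
theorem measure_Ioo_pos {π : Measure ℝ} [IsFiniteMeasure π] (h : π ≪ volume)
    (hπ : PolynomialAtOrigin π) {η : ℝ} (hη : 0 < η) : π (Ioo 0 η) ≠ 0 := by
  intro h0
  obtain ⟨ε, δ, β, hε, hδ, hb⟩ := hπ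
  have hm : 0 < min η ε := lt_min hη hε
  have h1 : π (Ioo 0 (min η ε)) = 0 :=
    measure_mono_null (Ioo_subset_Ioo_right (min_le_left _ _)) h0
  rw [← Measure.withDensity_rnDeriv_eq π volume h, withDensity_apply _ measurableSet_Ioo,
    lintegral_eq_zero_iff (Measure.measurable_rnDeriv _ _)] at h1
  have h2 : ∀ᵐ α ∂(volume.restrict (Ioo 0 (min η ε))), False := by
    rw [Filter.EventuallyEq, ae_restrict_iff' measurableSet_Ioo] at h1
    rw [ae_restrict_iff' measurableSet_Ioo]
    filter_upwards [h1, hb] with α h1 hb hα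
    have h3 := (hb ⟨hα.1, hα.2.trans_le (min_le_right _ _)⟩).1
    rw [h1 hα] at h3
    have : 0 < 1 / δ * α ^ β := mul_pos (by positivity) (Real.rpow_pos_of_pos hα.1 _)
    simp only [Pi.zero_apply, ENNReal.toReal_zero] at h3
    linarith
  rw [eventually_false_iff_eq_bot, ae_eq_bot, Measure.restrict_eq_zero, Real.volume_Ioo,
    ENNReal.ofReal_eq_zero] at h2
  linarith

/-! ### Exponential moments of the prior. -/

theorem summable_pow_mul_Gamma {r ν : ℝ} (hr : 0 < r) (hr1 : r < 1) (hν : 0 < ν) :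
    Summable fun s : ℕ => r ^ s * Real.Gamma (ν + s + 1) / s ! := by
  have hG : ∀ s : ℕ, 0 < Real.Gamma (ν + s + 1) := fun s => Real.Gamma_pos_of_pos (by positivity)
  refine summable_of_ratio_test_tendsto_lt_one hr1 (Eventually.of_forall fun s => ?_) ?_
  · have := hG s
    positivity
  · have h1 : ∀ s : ℕ, ‖r ^ (s + 1) * Real.Gamma (ν + (s + 1 : ℕ) + 1) / ((s + 1)! : ℝ)‖ /
        ‖r ^ s * Real.Gamma (ν + s + 1) / (s ! : ℝ)‖ = r * (1 + ν * (1 / ((s : ℝ) + 1))) := by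
      intro s
      have hs := hG s
      have hs' := hG (s + 1)
      rw [Real.norm_of_nonneg (by positivity), Real.norm_of_nonneg (by positivity)]
      have h2 : Real.Gamma (ν + (s + 1 : ℕ) + 1) = (ν + s + 1) * Real.Gamma (ν + s + 1) := by
        rw [← Real.Gamma_add_one (by positivity)]
        push_cast
        ring_nf
      rw [h2, Nat.factorial_succ]
      have h3 : ((s ! : ℕ) : ℝ) ≠ 0 := by positivity
      have h4 : (s : ℝ) + 1 ≠ 0 := by positivity
      push_cast
      field_simp
      ring
    simp_rw [h1]
    have h5 := (tendsto_one_div_add_atTop_nhds_zero_nat (𝕜 := ℝ)).const_mul ν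
    simpa using (h5.const_add 1).const_mul r

theorem ae_pos_of_measure_Iic {π : Measure ℝ} (hπpos : π (Iic 0) = 0) : ∀ᵐ α ∂π, 0 < α := by
  rw [ae_iff]
  simpa [Set.Iic] using hπpos

/-- The exponential series is integrated term by term; the moment bounds leave a series with ratio
tending to c / ρ < 1. -/
theorem integrable_exp_of_subfactorialMoments {π : Measure ℝ} [IsProbabilityMeasure π]
    (hπpos : π (Iic 0) = 0) {ρ c : ℝ} (hc : 0 < c) (hcρ : c < ρ)
    (h : SubfactorialMoments π ρ) : Integrable (fun α => Real.exp (c * α)) π := by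
  obtain ⟨D, ν, hD, hν, hb⟩ := h
  have hρ : 0 < ρ := hc.trans hcρ
  have hpos : ∀ᵐ α ∂π, 0 < α :=
    ae_pos_of_measure_Iic hπpos
  refine ⟨by fun_prop, ?_⟩
  rw [hasFiniteIntegral_iff_ofReal (Eventually.of_forall fun α => (Real.exp_pos _).le)]
  have h1 : ∫⁻ α, ENNReal.ofReal (Real.exp (c * α)) ∂π =
      ∑' s : ℕ, ENNReal.ofReal (c ^ s / s !) * ∫⁻ α, ENNReal.ofReal (α ^ s) ∂π := by
    rw [← tsum_congr fun s : ℕ => lintegral_const_mul (μ := π) (ENNReal.ofReal (c ^ s / s !))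
      (f := fun α : ℝ => ENNReal.ofReal (α ^ s)) (by fun_prop), ← lintegral_tsum (by fun_prop)]
    refine lintegral_congr_ae ?_
    filter_upwards [hpos] with α hα
    have h2 : Real.exp (c * α) = ∑' s : ℕ, (c ^ s / s !) * α ^ s := by
      rw [Real.exp_eq_exp_ℝ, NormedSpace.exp_eq_tsum_div]
      refine tsum_congr fun s => ?_
      rw [mul_pow]
      ring
    have h3 : Summable fun s : ℕ => (c ^ s / s !) * α ^ s := by
      refine (Real.summable_pow_div_factorial (c * α)).congr fun s => ?_
      rw [mul_pow]
      ring
    rw [h2, ENNReal.ofReal_tsum_of_nonneg (fun s => by positivity) h3]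
    exact tsum_congr fun s => ENNReal.ofReal_mul (by positivity)
  -- The term s = 0 is split off because the moment bounds start at s = 1.
  rw [h1, tsum_eq_zero_add' ENNReal.summable]
  refine ENNReal.add_lt_top.2 ⟨by simp, ?_⟩
  have h4 := (summable_pow_mul_Gamma (r := c / ρ) (ν := ν) (by positivity)
    ((div_lt_one hρ).2 hcρ) hν).mul_left D
  have hnn : ∀ s : ℕ, 0 ≤ D * ((c / ρ) ^ s * Real.Gamma (ν + s + 1) / s !) := fun s => by
    have := Real.Gamma_pos_of_pos (s := ν + s + 1) (by positivity)
    positivity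
  have h5 := (h4.tsum_ofReal_ne_top)
  refine lt_of_le_of_lt ?_ h5.lt_top
  refine le_trans ?_ (ENNReal.tsum_comp_le_tsum_of_injective (add_left_injective 1) _)
  refine ENNReal.tsum_le_tsum fun s => ?_
  refine (mul_le_mul_right (hb (s + 1) (by omega)).le _).trans ?_
  rw [← ENNReal.ofReal_mul (by positivity)]
  refine ENNReal.ofReal_le_ofReal (le_of_eq ?_)
  rw [div_pow]
  field_simp

/-- The integral of `α ^ s / ((α + 1) ⋯ (α + m))` with respect to the prior. -/
noncomputable def priorMoment (π : Measure ℝ) (m s : ℕ) : ℝ := ∫ α, α ^ s * ascWeight m α ∂π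

theorem integrable_mul_ascWeight {π : Measure ℝ} (hπpos : π (Iic 0) = 0) (m : ℕ) {f : ℝ → ℝ}
    (hf : Integrable f π) : Integrable (fun α => f α * ascWeight m α) π := by
  refine hf.mul_bdd (c := 1) (measurable_ascWeight m).aestronglyMeasurable ?_
  filter_upwards [ae_pos_of_measure_Iic hπpos] with α hα
  rw [Real.norm_of_nonneg (ascWeight_pos m hα.le).le]
  exact ascWeight_le_one m hα.le

/-- Concentration at 0: below η, monotonicity gives F ≤ F η, which is small; above η, the weight is
at most its value at η. -/
theorem tendsto_integral_mul_ascWeight_div {π : Measure ℝ} [IsProbabilityMeasure π]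
    (hπpos : π (Iic 0) = 0)
    (h0 : ∀ η, 0 < η → π (Ioo 0 η) ≠ 0) {F : ℝ → ℝ} (hF : Integrable F π)
    (hFmono : MonotoneOn F (Ici 0)) (hF0 : F 0 = 0) (hFc : ContinuousWithinAt F (Ici 0) 0) :
    Tendsto (fun m => (∫ α, F α * ascWeight m α ∂π) / ∫ α, ascWeight m α ∂π) atTop (nhds 0) := by
  have hpos := ae_pos_of_measure_Iic hπpos
  have hFnn : ∀ α, 0 ≤ α → 0 ≤ F α := fun α hα => hF0 ▸ hFmono self_mem_Ici hα hα
  have hw : ∀ m, Integrable (ascWeight m) π := fun m => by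
    simpa using integrable_mul_ascWeight hπpos m (integrable_const (1 : ℝ))
  have hFw := fun m => integrable_mul_ascWeight hπpos m hF
  have hI : 0 ≤ ∫ α, F α ∂π := integral_nonneg_of_ae (hpos.mono fun α hα => hFnn α hα.le)
  have hlow : ∀ m η, 0 < η → ascWeight m η * π.real (Ioo 0 η) ≤ ∫ α, ascWeight m α ∂π := by
    intro m η hη
    calc ascWeight m η * π.real (Ioo 0 η) = ∫ α in Ioo 0 η, ascWeight m η ∂π := by
          simp [mul_comm]
      _ ≤ ∫ α in Ioo 0 η, ascWeight m α ∂π :=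
          setIntegral_mono_on (integrable_const _).integrableOn (hw m).integrableOn
            measurableSet_Ioo fun α hα => ascWeight_antitone m hα.1.le hα.2.le
      _ ≤ ∫ α, ascWeight m α ∂π :=
          setIntegral_le_integral (hw m) (hpos.mono fun α hα => (ascWeight_pos m hα.le).le)
  have hreal : ∀ η, 0 < η → 0 < π.real (Ioo 0 η) := fun η hη =>
    ENNReal.toReal_pos (h0 η hη) (measure_ne_top _ _)
  have hden : ∀ m, 0 < ∫ α, ascWeight m α ∂π := fun m =>
    lt_of_lt_of_le (mul_pos (ascWeight_pos m zero_le_one) (hreal 1 one_pos)) (hlow m 1 one_pos)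
  have hup : ∀ m η, 0 < η → ∫ α, F α * ascWeight m α ∂π ≤
      F η * ∫ α, ascWeight m α ∂π + ascWeight m η * ∫ α, F α ∂π := by
    intro m η hη
    rw [← integral_const_mul, ← integral_const_mul,
      ← integral_add ((hw m).const_mul _) (hF.const_mul _)]
    refine integral_mono_ae (hFw m) (((hw m).const_mul _).add (hF.const_mul _)) ?_
    filter_upwards [hpos] with α hα
    have hwα := ascWeight_pos m hα.le
    have hwη := ascWeight_pos m hη.le
    rcases le_total α η with h | h
    · have h1 := mul_le_mul_of_nonneg_right (hFmono hα.le hη.le h) hwα.le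
      have h2 := mul_nonneg hwη.le (hFnn α hα.le)
      linarith
    · have h1 := mul_le_mul_of_nonneg_left (ascWeight_antitone m hη.le h) (hFnn α hα.le)
      have h2 := mul_nonneg (hFnn η hη.le) hwα.le
      linarith
  have hnum : ∀ m, 0 ≤ ∫ α, F α * ascWeight m α ∂π := fun m =>
    integral_nonneg_of_ae (hpos.mono fun α hα =>
      mul_nonneg (hFnn α hα.le) (ascWeight_pos m hα.le).le)
  rw [Metric.tendsto_atTop]
  intro e he
  obtain ⟨η, hη, hFη⟩ : ∃ η, 0 < η ∧ F η < e / 2 := by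
    have h1 : ∀ᶠ x in nhdsWithin 0 (Ioi (0 : ℝ)), F x < e / 2 := by
      have h2 : ContinuousWithinAt F (Ioi 0) 0 := hFc.mono Ioi_subset_Ici_self
      exact h2.eventually (by rw [hF0]; exact gt_mem_nhds (half_pos he))
    obtain ⟨x, hx, hx0⟩ := (h1.and self_mem_nhdsWithin).exists
    exact ⟨x, hx0, hx⟩
  -- The denominator is bounded below by the mass on (0, η / 2), whose weight dominates the weight
  -- at η.
  have ht := (tendsto_ascWeight_div (a := η / 2) (b := η) (by positivity) (by linarith)).mul_const
    ((∫ α, F α ∂π) / π.real (Ioo 0 (η / 2)))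
  rw [zero_mul] at ht
  obtain ⟨N, hN⟩ := eventually_atTop.1 (ht.eventually (gt_mem_nhds (half_pos he)))
  refine ⟨N, fun m hm => ?_⟩
  rw [Real.dist_eq, sub_zero, abs_of_nonneg (div_nonneg (hnum m) (hden m).le),
    div_lt_iff₀ (hden m)]
  have h3 := hN m hm
  have h4 := hlow m (η / 2) (by positivity)
  have h5 := hreal (η / 2) (by positivity)
  have h6 := ascWeight_pos m (α := η / 2) (by positivity)
  have h7 : ascWeight m η * ∫ α, F α ∂π = (ascWeight m η / ascWeight m (η / 2) *
      ((∫ α, F α ∂π) / π.real (Ioo 0 (η / 2)))) *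
        (ascWeight m (η / 2) * π.real (Ioo 0 (η / 2))) := by
    field_simp
  have h8 : ascWeight m η * ∫ α, F α ∂π ≤ e / 2 * ∫ α, ascWeight m α ∂π := by
    rw [h7]
    exact mul_le_mul h3.le h4 (mul_pos h6 h5).le (half_pos he).le
  have h9 := mul_lt_mul_of_pos_right hFη (hden m)
  have h10 := hup m η hη
  linarith

theorem integrable_pow_of_subfactorialMoments {π : Measure ℝ} [IsProbabilityMeasure π]
    (hπpos : π (Iic 0) = 0) {ρ : ℝ} (hρ : 38 ≤ ρ)
    (h : SubfactorialMoments π ρ) (s : ℕ) : Integrable (fun α => α ^ s) π := by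
  have h1 := (integrable_exp_of_subfactorialMoments hπpos (c := 1) one_pos (by linarith) h).const_mul
    (s ! : ℝ)
  refine h1.mono' (by fun_prop) ?_
  filter_upwards [ae_pos_of_measure_Iic hπpos] with α hα
  rw [Real.norm_of_nonneg (by positivity), one_mul]
  have h2 := Real.pow_div_factorial_le_exp α hα.le s
  rw [div_le_iff₀ (by positivity)] at h2
  linarith

theorem priorMoment_nonneg {π : Measure ℝ} (hπpos : π (Iic 0) = 0) (m s : ℕ) : 0 ≤ priorMoment π m s :=
  integral_nonneg_of_ae ((ae_pos_of_measure_Iic hπpos).mono fun α hα =>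
    mul_nonneg (by positivity) (ascWeight_pos m hα.le).le)

theorem priorMoment_zero_pos {π : Measure ℝ} [IsProbabilityMeasure π]
    (hπpos : π (Iic 0) = 0) (m : ℕ) : 0 < priorMoment π m 0 := by
  have hpos := ae_pos_of_measure_Iic hπpos
  have hw : Integrable (ascWeight m) π := by
    simpa using integrable_mul_ascWeight hπpos m (integrable_const (1 : ℝ))
  simp only [priorMoment, pow_zero, one_mul]
  rw [integral_pos_iff_support_of_nonneg_ae
    (hpos.mono fun α hα => (ascWeight_pos m hα.le).le) hw]
  refine pos_iff_ne_zero.2 fun h => ?_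
  have h1 : ∀ᵐ α ∂π, False := by
    filter_upwards [hpos, measure_eq_zero_iff_ae_notMem.1 h] with α hα hα'
    exact hα' (ascWeight_pos m hα.le).ne'
  exact IsProbabilityMeasure.ne_zero π (ae_eq_bot.1 (eventually_false_iff_eq_bot.1 h1))

/-- The prior odds of `s + 2` clusters against one, weighted by `16 ^ (s + 2) / (s + 2)!`, are
negligible. -/
theorem tendsto_sum_priorMoment_div {π : Measure ℝ} [IsProbabilityMeasure π]
    (hπpos : π (Iic 0) = 0) (hA1 : π ≪ volume)
    (hA2 : PolynomialAtOrigin π) {ρ : ℝ} (hρ : 38 ≤ ρ) (hA3 : SubfactorialMoments π ρ) :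
    Tendsto (fun m => (∑ s ∈ Finset.range m, 16 ^ (s + 2) / (s + 2)! * priorMoment π m (s + 1)) /
      priorMoment π m 0) atTop (nhds 0) := by
  have hpos := ae_pos_of_measure_Iic hπpos
  -- Dominating function: 16² comes out of 16^(s + 2), and the rest is an exponential series. The
  -- factor α is absorbed by e^α, and 17 < 38 ≤ ρ.
  have hFint : Integrable (fun α => 256 * (α * Real.exp (16 * α))) π := by
    have h1 := (integrable_exp_of_subfactorialMoments hπpos (c := 17) (by norm_num)
      (by linarith) hA3).const_mul 256
    refine h1.mono' (by fun_prop) ?_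
    filter_upwards [hpos] with α hα
    rw [Real.norm_of_nonneg (by positivity)]
    have h2 : α ≤ Real.exp α := by linarith [Real.add_one_le_exp α]
    have h3 : Real.exp (17 * α) = Real.exp α * Real.exp (16 * α) := by
      rw [← Real.exp_add]
      ring_nf
    rw [h3]
    gcongr
  have hmain := tendsto_integral_mul_ascWeight_div hπpos (fun η hη => measure_Ioo_pos hA1 hA2 hη)
    hFint (fun x hx y hy hxy => by
      have hx' : (0 : ℝ) ≤ x := hx
      have hy' : (0 : ℝ) ≤ y := hy
      gcongr) (by simp) (by fun_prop)
  have hz : ∀ m, priorMoment π m 0 = ∫ α, ascWeight m α ∂π := fun m => by simp [priorMoment]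
  refine squeeze_zero (fun m => ?_) (fun m => ?_) hmain
  · refine div_nonneg (Finset.sum_nonneg fun s _ => ?_) (priorMoment_nonneg hπpos _ _)
    exact mul_nonneg (by positivity) (priorMoment_nonneg hπpos _ _)
  · rw [← hz]
    refine div_le_div_of_nonneg_right ?_ (priorMoment_nonneg hπpos _ _)
    have hint : ∀ s, Integrable (fun α => α ^ s * ascWeight m α) π := fun s =>
      integrable_mul_ascWeight hπpos m (integrable_pow_of_subfactorialMoments hπpos hρ hA3 s)
    simp only [priorMoment, ← integral_const_mul]
    rw [← integral_finsetSum _ fun s _ => (hint (s + 1)).const_mul _]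
    refine integral_mono_ae (integrable_finsetSum _ fun s _ => (hint (s + 1)).const_mul _)
      (integrable_mul_ascWeight hπpos m hFint) ?_
    filter_upwards [hpos] with α hα
    have h4 : ∑ s ∈ Finset.range m, (16 * α) ^ s / s ! ≤ Real.exp (16 * α) :=
      Real.sum_le_exp_of_nonneg (by positivity) m
    calc ∑ s ∈ Finset.range m, 16 ^ (s + 2) / ((s + 2)! : ℝ) * (α ^ (s + 1) * ascWeight m α)
        ≤ ∑ s ∈ Finset.range m, 256 * α * ascWeight m α * ((16 * α) ^ s / s !) := by
          refine Finset.sum_le_sum fun s _ => ?_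
          have h5 : (s ! : ℝ) ≤ (s + 2)! := by exact_mod_cast Nat.factorial_le (by omega)
          have h6 := (ascWeight_pos m hα.le).le
          calc _ = 256 * α * ascWeight m α * ((16 * α) ^ s / (s + 2)!) := by
                rw [mul_pow]
                ring
            _ ≤ _ := by gcongr
      _ = 256 * (α * ∑ s ∈ Finset.range m, (16 * α) ^ s / s !) * ascWeight m α := by
          rw [← Finset.mul_sum]
          ring
      _ ≤ _ := by
          have h6 := (ascWeight_pos m hα.le).le
          gcongr

end Prior

end DPMixture

namespace DPMixture

/-! ### Marginal likelihoods of the uniform kernel -/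

section Likelihood

theorem uniformPDF_Ioo {c : ℝ} (θ x : ℝ) :
    pdf.uniformPDF (Ioo (θ - c) (θ + c)) x =
      if x ∈ Ioo (θ - c) (θ + c) then (ENNReal.ofReal (2 * c))⁻¹ else 0 := by
  rw [pdf.uniformPDF_ite, Real.volume_Ioo]
  ring_nf

theorem unifDensity_eq_ite {c : ℝ} (hc : 0 < c) (θ x : ℝ) :
    unifDensity c θ x = if x ∈ Ioo (θ - c) (θ + c) then (2 * c)⁻¹ else 0 := by
  rw [unifDensity, uniformPDF_Ioo]
  split_ifs
  · rw [ENNReal.toReal_inv, ENNReal.toReal_ofReal (by positivity)]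
  · rfl

theorem unifDensity_nonneg (c θ x : ℝ) : 0 ≤ unifDensity c θ x := ENNReal.toReal_nonneg

theorem unifDensity_le {c : ℝ} (hc : 0 < c) (θ x : ℝ) : unifDensity c θ x ≤ (2 * c)⁻¹ := by
  rw [unifDensity_eq_ite hc]
  split_ifs
  · exact le_rfl
  · positivity

theorem measurable_unifDensity {c : ℝ} (hc : 0 < c) :
    Measurable fun p : ℝ × ℝ => unifDensity c p.2 p.1 := by
  simp_rw [unifDensity_eq_ite hc]
  have h1 : MeasurableSet {p : ℝ × ℝ | p.2 - c < p.1} :=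
    measurableSet_lt (by fun_prop) (by fun_prop)
  have h2 : MeasurableSet {p : ℝ × ℝ | p.1 < p.2 + c} :=
    measurableSet_lt (by fun_prop) (by fun_prop)
  exact Measurable.ite (h1.inter h2) measurable_const measurable_const

theorem integrable_unifDensity {c : ℝ} (hc : 0 < c) (θ : ℝ) : Integrable (unifDensity c θ) := by
  have : unifDensity c θ = (Ioo (θ - c) (θ + c)).indicator fun _ => (2 * c)⁻¹ := by
    ext x
    rw [unifDensity_eq_ite hc, Set.indicator_apply]
  rw [this, integrable_indicator_iff measurableSet_Ioo]
  exact integrableOn_const (by simp)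

theorem integrable_prod_unifDensity_mul {ι : Type*} {c : ℝ} (hc : 0 < c) (θstar : ℝ) (x : ι → ℝ)
    (B : Finset ι) :
    Integrable fun θ => (∏ i ∈ B, unifDensity c θ (x i)) * unifDensity c θstar θ := by
  refine (integrable_unifDensity hc θstar).bdd_mul (c := ((2 * c)⁻¹) ^ B.card)
    (Finset.measurable_fun_prod _ fun i _ =>
      (measurable_unifDensity hc).comp (measurable_const.prodMk measurable_id)).aestronglyMeasurable
    (Eventually.of_forall fun θ => ?_)
  rw [Real.norm_of_nonneg (Finset.prod_nonneg fun i _ => unifDensity_nonneg _ _ _)]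
  rw [← Finset.prod_const]
  exact Finset.prod_le_prod (fun i _ => unifDensity_nonneg _ _ _) fun i _ => unifDensity_le hc _ _

theorem marginalLikelihood_nonneg {n : ℕ} (c θstar : ℝ) (x : Fin n → ℝ) (B : Finset (Fin n)) :
    0 ≤ marginalLikelihood (fun x θ => unifDensity c θ x) (unifDensity c θstar) x B :=
  integral_nonneg fun _ => mul_nonneg (Finset.prod_nonneg fun _ _ => unifDensity_nonneg _ _ _)
    (unifDensity_nonneg _ _ _)

theorem ofReal_marginalLikelihood {n : ℕ} {c : ℝ} (hc : 0 < c) (θstar : ℝ) (x : Fin n → ℝ)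
    (B : Finset (Fin n)) :
    ENNReal.ofReal (marginalLikelihood (fun x θ => unifDensity c θ x) (unifDensity c θstar) x B) =
      ∫⁻ θ, ENNReal.ofReal ((∏ i ∈ B, unifDensity c θ (x i)) * unifDensity c θstar θ) := by
  rw [marginalLikelihood, ofReal_integral_eq_lintegral_ofReal
    (integrable_prod_unifDensity_mul hc θstar x B)]
  exact Eventually.of_forall fun θ => mul_nonneg
    (Finset.prod_nonneg fun i _ => unifDensity_nonneg _ _ _) (unifDensity_nonneg _ _ _)

/-- If all observations keep the distance `δ` from the end points of the support, the marginal
likelihood is at least `δ / c` times its maximal value. -/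
theorem le_marginalLikelihood {n : ℕ} {c : ℝ} (hc : 0 < c) (θstar : ℝ) {δ : ℝ} (hδ : 0 ≤ δ)
    (hδc : δ ≤ c) (x : Fin n → ℝ) (B : Finset (Fin n))
    (hx : ∀ i ∈ B, x i ∈ Ioo (θstar - c + δ) (θstar + c - δ)) :
    ((2 * c)⁻¹) ^ B.card * (δ / c) ≤
      marginalLikelihood (fun x θ => unifDensity c θ x) (unifDensity c θstar) x B := by
  have hint := integrable_prod_unifDensity_mul hc θstar x B
  calc ((2 * c)⁻¹) ^ B.card * (δ / c)
      -- For θ within δ of θ*, every observation of the block lies in the support of the kernel at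
      -- θ.
      = ∫ θ in Ioo (θstar - δ) (θstar + δ), ((2 * c)⁻¹) ^ B.card * (2 * c)⁻¹ := by
        rw [setIntegral_const, Measure.real, Real.volume_Ioo,
          ENNReal.toReal_ofReal (by linarith), smul_eq_mul]
        field_simp
        ring
    _ ≤ ∫ θ in Ioo (θstar - δ) (θstar + δ),
          (∏ i ∈ B, unifDensity c θ (x i)) * unifDensity c θstar θ := by
        refine setIntegral_mono_on (integrableOn_const (by simp)) hint.integrableOn
          measurableSet_Ioo fun θ hθ => ?_
        rw [unifDensity_eq_ite hc θstar, if_pos ⟨by linarith [hθ.1], by linarith [hθ.2]⟩,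
          Finset.prod_congr rfl fun i hi => ?_, Finset.prod_const]
        rw [unifDensity_eq_ite hc, if_pos]
        exact ⟨by linarith [hθ.2, (hx i hi).1], by linarith [hθ.1, (hx i hi).2]⟩
    _ ≤ _ := setIntegral_le_integral hint (Eventually.of_forall fun θ => mul_nonneg
        (Finset.prod_nonneg fun i _ => unifDensity_nonneg _ _ _) (unifDensity_nonneg _ _ _))

/-- By symmetry, twice an explicit integral over [0, c], whose negative boundary term is dropped.
With t = θ - θ*, the base is the relative overlap of the two intervals. -/
theorem integral_one_sub_abs_div_pow_le {c : ℝ} (hc : 0 < c) (a : ℕ) :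
    ∫ t in -c..c, (1 - |t| / (2 * c)) ^ a ≤ 2 * c * (2 / (a + 1)) := by
  have hint : ∀ x y : ℝ, IntervalIntegrable (fun t : ℝ => (1 - |t| / (2 * c)) ^ a) volume x y :=
    fun x y => Continuous.intervalIntegrable (by fun_prop) x y
  have hright : ∫ t in (0 : ℝ)..c, (1 - |t| / (2 * c)) ^ a ≤ 2 * c / (a + 1) := by
    have h1 : ∫ t in (0 : ℝ)..c, (1 - |t| / (2 * c)) ^ a =
        ∫ t in (0 : ℝ)..c, (1 - t / (2 * c)) ^ a := by
      refine intervalIntegral.integral_congr fun t ht => ?_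
      rw [uIcc_of_le hc.le] at ht
      simp only [abs_of_nonneg ht.1]
    have h2 : ∀ t ∈ uIcc (0 : ℝ) c, HasDerivAt
        (fun t : ℝ => -(2 * c / (a + 1)) * (1 - t / (2 * c)) ^ (a + 1))
        ((1 - t / (2 * c)) ^ a) t := by
      intro t _
      have h3 := ((((hasDerivAt_id t).div_const (2 * c)).const_sub 1).pow (a + 1)).const_mul
        (-(2 * c / (a + 1)))
      refine h3.congr_deriv ?_
      have : (a : ℝ) + 1 ≠ 0 := by positivity
      push_cast
      simp only [id]
      field_simp
    rw [h1, intervalIntegral.integral_eq_sub_of_hasDerivAt h2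
      (Continuous.intervalIntegrable (by fun_prop) _ _)]
    have h4 : 0 ≤ 1 - c / (2 * c) := by
      rw [sub_nonneg, div_le_one (by positivity)]
      linarith
    have h5 : 0 ≤ 2 * c / (a + 1) * (1 - c / (2 * c)) ^ (a + 1) := by positivity
    simp only [zero_div, sub_zero, one_pow]
    linarith
  have hleft : ∫ t in -c..0, (1 - |t| / (2 * c)) ^ a = ∫ t in (0 : ℝ)..c, (1 - |t| / (2 * c)) ^ a := by
    have := intervalIntegral.integral_comp_neg (a := 0) (b := c)
      fun t : ℝ => (1 - |t| / (2 * c)) ^ a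
    simp only [abs_neg, neg_zero] at this
    exact this.symm
  rw [← intervalIntegral.integral_add_adjacent_intervals (hint (-c) 0) (hint 0 c), hleft]
  calc _ ≤ 2 * c / (a + 1) + 2 * c / (a + 1) := add_le_add hright hright
    _ = _ := by ring

end Likelihood

/-! ### Independent blocks of observations -/

section Independence

variable {Ω : Type*} [MeasurableSpace Ω] {P : Measure Ω}

/-- Each factor is measurable for the σ-algebra of its own block, so blocks can be peeled off one at
a time by independence. -/
theorem lintegral_prod_eq_prod_lintegral_of_disjoint {ι β : Type*} [DecidableEq ι]
    [MeasurableSpace β] {Y : ι → Ω → β} (hYm : ∀ i, Measurable (Y i)) (hY : iIndepFun Y P)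
    {G : Finset ι → Ω → ENNReal}
    (hG : ∀ B : Finset ι, Measurable[⨆ i ∈ (B : Set ι), MeasurableSpace.comap (Y i) inferInstance] (G B))
    (𝒜 : Finset (Finset ι)) (h𝒜 : (𝒜 : Set (Finset ι)).PairwiseDisjoint id) :
    ∫⁻ ω, ∏ B ∈ 𝒜, G B ω ∂P = ∏ B ∈ 𝒜, ∫⁻ ω, G B ω ∂P := by
  have : IsProbabilityMeasure P := hY.isProbabilityMeasure
  have hle : ∀ i, MeasurableSpace.comap (Y i) inferInstance ≤ ‹MeasurableSpace Ω› :=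
    fun i => (hYm i).comap_le
  have hle' : ∀ S : Set ι, ⨆ i ∈ S, MeasurableSpace.comap (Y i) inferInstance ≤
      ‹MeasurableSpace Ω› := fun S => iSup₂_le fun i _ => hle i
  induction 𝒜 using Finset.induction_on with
  | empty => simp
  | insert B 𝒜 hB ih =>
    have h𝒜' : (𝒜 : Set (Finset ι)).PairwiseDisjoint id :=
      h𝒜.subset (by simp)
    rw [Finset.prod_insert hB, ← ih h𝒜']
    simp only [Finset.prod_insert hB]
    have hdisj : Disjoint (B : Set ι) (𝒜.biUnion id : Finset ι) := by
      rw [Finset.disjoint_coe, Finset.disjoint_biUnion_right]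
      intro C hC
      exact h𝒜 (by simp) (by simp [hC]) fun h => hB (h ▸ hC)
    refine lintegral_mul_eq_lintegral_mul_lintegral_of_independent_measurableSpace
      (hle' _) (hle' _) (indep_iSup_of_disjoint hle hY.iIndep hdisj) (hG B) ?_
    refine Finset.measurable_fun_prod _ fun C hC => (hG C).mono ?_ le_rfl
    refine biSup_mono fun i hi => ?_
    exact Finset.mem_coe.2 (Finset.mem_biUnion.2 ⟨C, hC, hi⟩)

/-- The measurable space is arbitrary so that it can be the σ-algebra generated by the observations
of one block. -/
theorem measurable_lintegral_prod_unifDensity {Ω' ι : Type*} [MeasurableSpace Ω'] {c : ℝ}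
    (hc : 0 < c) (θstar : ℝ) {Y : ι → Ω' → ℝ} (B : Finset ι) (hY : ∀ i ∈ B, Measurable (Y i)) :
    Measurable fun ω => ∫⁻ θ, ENNReal.ofReal
      ((∏ i ∈ B, unifDensity c θ (Y i ω)) * unifDensity c θstar θ) := by
  refine Measurable.lintegral_prod_right' (f := fun p : Ω' × ℝ => ENNReal.ofReal
      ((∏ i ∈ B, unifDensity c p.2 (Y i p.1)) * unifDensity c θstar p.2)) ?_
  refine ENNReal.measurable_ofReal.comp (Measurable.mul ?_ ?_)
  · exact Finset.measurable_fun_prod _ fun i hi => (measurable_unifDensity hc).comp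
      (((hY i hi).comp measurable_fst).prodMk measurable_snd)
  · exact (measurable_unifDensity hc).comp (measurable_snd.prodMk measurable_const)

end Independence

/-! ### Uniform data -/

section Data

variable {Ω : Type*} [MeasurableSpace Ω] {P : Measure Ω}

theorem measure_preimage_Ioo_of_isUniform {c θstar : ℝ} (hc : 0 < c) {Y : Ω → ℝ}
    (hY : pdf.IsUniform Y (Ioo (θstar - c) (θstar + c)) P volume) (a b : ℝ) :
    P (Y ⁻¹' Ioo a b) =
      ENNReal.ofReal ((min (θstar + c) b - max (θstar - c) a) / (2 * c)) := by
  have hv : volume (Ioo (θstar - c) (θstar + c)) = ENNReal.ofReal (2 * c) := by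
    rw [Real.volume_Ioo]
    ring_nf
  rw [hY.measure_preimage (by rw [hv]; simpa using hc) (by rw [hv]; exact ENNReal.ofReal_ne_top) measurableSet_Ioo,
    Ioo_inter_Ioo, Real.volume_Ioo, hv, ENNReal.ofReal_div_of_pos (by positivity)]

theorem measure_notMem_Ioo_of_isUniform [IsProbabilityMeasure P] {c θstar : ℝ} (hc : 0 < c)
    {Y : Ω → ℝ} (hYm : Measurable Y)
    (hY : pdf.IsUniform Y (Ioo (θstar - c) (θstar + c)) P volume) {δ : ℝ} (hδ : 0 ≤ δ)
    (hδc : δ ≤ c) :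
    P {ω | Y ω ∉ Ioo (θstar - c + δ) (θstar + c - δ)} = ENNReal.ofReal (δ / c) := by
  have h1 : {ω | Y ω ∉ Ioo (θstar - c + δ) (θstar + c - δ)} =
      (Y ⁻¹' Ioo (θstar - c + δ) (θstar + c - δ))ᶜ := rfl
  rw [h1, prob_compl_eq_one_sub (hYm measurableSet_Ioo), measure_preimage_Ioo_of_isUniform hc hY,
    min_eq_right (by linarith), max_eq_right (by linarith), ← ENNReal.ofReal_one,
    ← ENNReal.ofReal_sub _ (div_nonneg (by linarith) (by linarith))]
  congr 1
  field_simp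
  ring

/-- Two intervals of length 2c with centres θ and θ* overlap in length 2c - |θ - θ*|, when this is
positive. -/
theorem lintegral_ofReal_unifDensity_le {c θstar θ : ℝ} (hc : 0 < c) {Y : Ω → ℝ} (hYm : Measurable Y)
    (hY : pdf.IsUniform Y (Ioo (θstar - c) (θstar + c)) P volume) :
    ∫⁻ ω, ENNReal.ofReal (unifDensity c θ (Y ω)) ∂P ≤
      ENNReal.ofReal ((2 * c)⁻¹ * (1 - |θ - θstar| / (2 * c))) := by
  have h1 : ∀ ω, ENNReal.ofReal (unifDensity c θ (Y ω)) =
      (Y ⁻¹' Ioo (θ - c) (θ + c)).indicator (fun _ => ENNReal.ofReal (2 * c)⁻¹) ω := by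
    intro ω
    rw [unifDensity_eq_ite hc]
    by_cases h : Y ω ∈ Ioo (θ - c) (θ + c)
    · rw [if_pos h, Set.indicator_of_mem (mem_preimage.2 h)]
    · rw [if_neg h, Set.indicator_of_notMem (mt mem_preimage.1 h), ENNReal.ofReal_zero]
  simp_rw [h1]
  rw [lintegral_indicator (hYm measurableSet_Ioo), setLIntegral_const,
    measure_preimage_Ioo_of_isUniform hc hY, ← ENNReal.ofReal_mul (by positivity)]
  refine ENNReal.ofReal_le_ofReal (mul_le_mul_of_nonneg_left ?_ (by positivity))
  rw [one_sub_div (by positivity)]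
  refine div_le_div_of_nonneg_right ?_ (by positivity)
  rcases abs_cases (θ - θstar) with ⟨h, -⟩ | ⟨h, -⟩ <;> rw [h]
  · linarith [min_le_left (θstar + c) (θ + c), le_max_right (θstar - c) (θ - c)]
  · linarith [min_le_right (θstar + c) (θ + c), le_max_left (θstar - c) (θ - c)]

/-- The expected marginal likelihood of a block of size `a` is at most `2 / (a + 1)` times its
maximal value. -/
theorem lintegral_marginalLikelihood_le {n : ℕ} {c : ℝ} (hc : 0 < c) (θstar : ℝ)
    [IsProbabilityMeasure P] {Y : Fin n → Ω → ℝ} (hYm : ∀ i, Measurable (Y i))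
    (hYi : iIndepFun Y P)
    (hY : ∀ i, pdf.IsUniform (Y i) (Ioo (θstar - c) (θstar + c)) P volume) (B : Finset (Fin n)) :
    ∫⁻ ω, ENNReal.ofReal (marginalLikelihood (fun x θ => unifDensity c θ x)
      (unifDensity c θstar) (fun i => Y i ω) B) ∂P ≤
        ENNReal.ofReal (((2 * c)⁻¹) ^ B.card * (2 / (B.card + 1))) := by
  simp_rw [ofReal_marginalLikelihood hc]
  rw [lintegral_lintegral_swap]
  swap
  · refine Measurable.aemeasurable (ENNReal.measurable_ofReal.comp (Measurable.mul ?_ ?_))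
    · exact Finset.measurable_fun_prod _ fun i hi => (measurable_unifDensity hc).comp
        (((hYm i).comp measurable_fst).prodMk measurable_snd)
    · exact (measurable_unifDensity hc).comp (measurable_snd.prodMk measurable_const)
  have hm : ∀ θ, Measurable fun x => ENNReal.ofReal (unifDensity c θ x) := fun θ =>
    ENNReal.measurable_ofReal.comp
      ((measurable_unifDensity hc).comp (measurable_id.prodMk measurable_const))
  -- After Tonelli, the observations are independent for fixed θ, so the expected product is a power
  -- of the single-observation bound.
  have h1 : ∀ θ, ∫⁻ ω, ENNReal.ofReal
      ((∏ i ∈ B, unifDensity c θ (Y i ω)) * unifDensity c θstar θ) ∂P ≤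
      (Ioo (θstar - c) (θstar + c)).indicator (fun θ => ENNReal.ofReal (((2 * c)⁻¹) ^ B.card *
        (2 * c)⁻¹ * (1 - |θ - θstar| / (2 * c)) ^ B.card)) θ := by
    intro θ
    rw [unifDensity_eq_ite hc θstar, Set.indicator_apply]
    split_ifs with hθ
    · have hθ' : |θ - θstar| ≤ c := abs_le.2 ⟨by linarith [hθ.1], by linarith [hθ.2]⟩
      have h0 : 0 ≤ 1 - |θ - θstar| / (2 * c) := by
        rw [sub_nonneg, div_le_one (by positivity)]
        linarith
      have h2 : ∀ ω, ENNReal.ofReal ((∏ i ∈ B, unifDensity c θ (Y i ω)) * (2 * c)⁻¹) =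
          ENNReal.ofReal (2 * c)⁻¹ * ∏ i ∈ B, ENNReal.ofReal (unifDensity c θ (Y i ω)) := by
        intro ω
        rw [mul_comm, ENNReal.ofReal_mul (by positivity),
          ENNReal.ofReal_prod_of_nonneg fun i _ => unifDensity_nonneg _ _ _]
      simp_rw [h2]
      have hYθ : ∀ i, Measurable fun ω => ENNReal.ofReal (unifDensity c θ (Y i ω)) := fun i =>
        (hm θ).comp (hYm i)
      rw [lintegral_const_mul _ (Finset.measurable_fun_prod _ fun i _ => hYθ i),
        lintegral_prod_eq_prod_lintegral_of_indepFun B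
          (fun i ω => ENNReal.ofReal (unifDensity c θ (Y i ω))) (hYi.comp _ fun _ => hm θ)
          hYθ]
      calc _ ≤ ENNReal.ofReal (2 * c)⁻¹ *
            ∏ i ∈ B, ENNReal.ofReal ((2 * c)⁻¹ * (1 - |θ - θstar| / (2 * c))) := by
            gcongr with i _
            exact lintegral_ofReal_unifDensity_le hc (hYm i) (hY i)
        _ = _ := by
            rw [Finset.prod_const, ← ENNReal.ofReal_pow (by positivity),
              ← ENNReal.ofReal_mul (by positivity), mul_pow]
            congr 1
            ring
    · simp
  refine (lintegral_mono h1).trans ?_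
  rw [lintegral_indicator measurableSet_Ioo, ← ofReal_integral_eq_lintegral_ofReal]
  · refine ENNReal.ofReal_le_ofReal ?_
    rw [← integral_Ioc_eq_integral_Ioo, ← intervalIntegral.integral_of_le (by linarith),
      intervalIntegral.integral_const_mul, intervalIntegral.integral_comp_sub_right
        (fun t => (1 - |t| / (2 * c)) ^ B.card)]
    have h3 := integral_one_sub_abs_div_pow_le hc B.card
    have h4 : θstar - c - θstar = -c := by ring
    have h5 : θstar + c - θstar = c := by ring
    rw [h4, h5]
    calc _ ≤ ((2 * c)⁻¹) ^ B.card * (2 * c)⁻¹ * (2 * c * (2 / (B.card + 1))) := by gcongr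
      _ = _ := by
        have : (2 * c) ≠ 0 := by positivity
        rw [mul_assoc, inv_mul_cancel_left₀ this]
  · exact (Continuous.integrableOn_Icc (by fun_prop)).mono_set Ioo_subset_Icc_self
  · refine (ae_restrict_iff' measurableSet_Ioo).2 (Eventually.of_forall fun θ hθ => ?_)
    have hθ' : |θ - θstar| ≤ c := abs_le.2 ⟨by linarith [hθ.1], by linarith [hθ.2]⟩
    have h0 : 0 ≤ 1 - |θ - θstar| / (2 * c) := by
      rw [sub_nonneg, div_le_one (by positivity)]
      linarith
    simp only [Pi.zero_apply]
    positivity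

theorem lintegral_prod_marginalLikelihood_le {n : ℕ} {c : ℝ} (hc : 0 < c) (θstar : ℝ)
    [IsProbabilityMeasure P] {Y : Fin n → Ω → ℝ} (hYm : ∀ i, Measurable (Y i))
    (hYi : iIndepFun Y P)
    (hY : ∀ i, pdf.IsUniform (Y i) (Ioo (θstar - c) (θstar + c)) P volume)
    (A : Finpartition (Finset.univ : Finset (Fin n))) :
    ∫⁻ ω, ENNReal.ofReal (∏ B ∈ A.parts, marginalLikelihood (fun x θ => unifDensity c θ x)
      (unifDensity c θstar) (fun i => Y i ω) B) ∂P ≤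
        ENNReal.ofReal (((2 * c)⁻¹) ^ n * ∏ B ∈ A.parts, 2 / ((B.card : ℝ) + 1)) := by
  simp_rw [ENNReal.ofReal_prod_of_nonneg fun B (_ : B ∈ A.parts) =>
    marginalLikelihood_nonneg c θstar _ B]
  rw [lintegral_prod_eq_prod_lintegral_of_disjoint hYm hYi _ _ A.disjoint]
  · refine (Finset.prod_le_prod' fun B _ =>
      lintegral_marginalLikelihood_le hc θstar hYm hYi hY B).trans (le_of_eq ?_)
    rw [← ENNReal.ofReal_prod_of_nonneg fun B _ => by positivity, Finset.prod_mul_distrib,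
      Finset.prod_pow_eq_pow_sum, A.sum_card_parts, Finset.card_univ, Fintype.card_fin]
  · intro B
    simp only [ofReal_marginalLikelihood hc]
    refine @measurable_lintegral_prod_unifDensity Ω (Fin n)
      (⨆ i ∈ (B : Set (Fin n)), MeasurableSpace.comap (Y i) inferInstance) c hc θstar Y B ?_
    intro i hi
    exact Measurable.of_comap_le (le_iSup₂_of_le i (Finset.mem_coe.2 hi) le_rfl)

end Data

end DPMixture

namespace DPMixture

/-! ### The posterior of the number of clusters -/

section Posterior

theorem partitionProb_eq {π : Measure ℝ} (hπpos : π (Iic 0) = 0) {m s : ℕ}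
    (A : Finpartition (Finset.univ : Finset (Fin (m + 1)))) (hA : A.parts.card = s + 1) :
    partitionProb π A = priorMoment π m s * ∏ B ∈ A.parts, ((B.card - 1)! : ℝ) := by
  rw [partitionProb, priorMoment, ← integral_mul_const]
  refine integral_congr_ae ?_
  filter_upwards [ae_pos_of_measure_Iic hπpos] with α hα
  rw [partitionProbGiven, hA, pow_div_ascFactorial hα]

theorem partitionProb_nonneg {π : Measure ℝ} (hπpos : π (Iic 0) = 0) {n : ℕ}
    (A : Finpartition (Finset.univ : Finset (Fin n))) : 0 ≤ partitionProb π A := by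
  refine integral_nonneg_of_ae ((ae_pos_of_measure_Iic hπpos).mono fun α hα => ?_)
  exact mul_nonneg (div_nonneg (by positivity) (Finset.prod_nonneg fun i _ => by positivity))
    (Finset.prod_nonneg fun _ _ => by positivity)

theorem jointDensity_nonneg {π : Measure ℝ} (hπpos : π (Iic 0) = 0) {n : ℕ} (c θstar : ℝ)
    (x : Fin n → ℝ) (s : ℕ) :
    0 ≤ jointDensity (fun x θ => unifDensity c θ x) (unifDensity c θstar) π x s :=
  Finset.sum_nonneg fun A _ => mul_nonneg (partitionProb_nonneg hπpos A)
    (Finset.prod_nonneg fun B _ => marginalLikelihood_nonneg c θstar x B)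

theorem jointDensity_zero {n : ℕ} (k : ℝ → ℝ → ℝ) (q₀ : ℝ → ℝ) (π : Measure ℝ)
    (x : Fin (n + 1) → ℝ) : jointDensity k q₀ π x 0 = 0 := by
  refine Finset.sum_eq_zero fun A hA => ?_
  have h := A.sup_parts
  rw [Finset.card_eq_zero.1 (Finset.mem_filter.1 hA).2, Finset.sup_empty] at h
  exact absurd h.symm Finset.univ_nonempty.ne_empty

/-- Only the partition with the single block `Finset.univ` is kept; its factor is (n - 1)! = m!. -/
theorem le_jointDensity_one {π : Measure ℝ} (hπpos : π (Iic 0) = 0) {m : ℕ} (c θstar : ℝ)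
    (x : Fin (m + 1) → ℝ) :
    priorMoment π m 0 * m ! * marginalLikelihood (fun x θ => unifDensity c θ x)
      (unifDensity c θstar) x Finset.univ ≤
        jointDensity (fun x θ => unifDensity c θ x) (unifDensity c θstar) π x 1 := by
  have hne : (Finset.univ : Finset (Fin (m + 1))) ≠ ⊥ := Finset.univ_nonempty.ne_empty
  have hp : (Finpartition.indiscrete hne).parts = {Finset.univ} := rfl
  have hmem : Finpartition.indiscrete hne ∈ partitionsInto (m + 1) 1 :=
    Finset.mem_filter.2 ⟨Finset.mem_univ _, by rw [hp, Finset.card_singleton]⟩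
  refine le_trans (le_of_eq ?_) (Finset.single_le_sum (f := fun A => partitionProb π A *
    ∏ B ∈ A.parts, marginalLikelihood (fun x θ => unifDensity c θ x) (unifDensity c θstar) x B)
    (fun A _ => mul_nonneg (partitionProb_nonneg hπpos A)
      (Finset.prod_nonneg fun B _ => marginalLikelihood_nonneg c θstar x B)) hmem)
  rw [partitionProb_eq hπpos (s := 0) _ (by rw [hp, Finset.card_singleton]), hp,
    Finset.prod_singleton, Finset.prod_singleton, Finset.card_univ, Fintype.card_fin,
    Nat.add_sub_cancel]

variable {Ω : Type*} [MeasurableSpace Ω] {P : Measure Ω}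

theorem measurable_marginalLikelihood {n : ℕ} {c : ℝ} (hc : 0 < c) (θstar : ℝ)
    {Y : Fin n → Ω → ℝ} (hYm : ∀ i, Measurable (Y i)) (B : Finset (Fin n)) :
    Measurable fun ω => marginalLikelihood (fun x θ => unifDensity c θ x) (unifDensity c θstar)
      (fun i => Y i ω) B := by
  have h := (measurable_lintegral_prod_unifDensity hc θstar B fun i _ => hYm i).ennreal_toReal
  simp_rw [← ofReal_marginalLikelihood hc,
    ENNReal.toReal_ofReal (marginalLikelihood_nonneg _ _ _ _)] at h
  exact h

theorem measurable_jointDensity {n : ℕ} {c : ℝ} (hc : 0 < c) (θstar : ℝ) (π : Measure ℝ)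
    {Y : Fin n → Ω → ℝ} (hYm : ∀ i, Measurable (Y i)) (s : ℕ) :
    Measurable fun ω => jointDensity (fun x θ => unifDensity c θ x) (unifDensity c θstar) π
      (fun i => Y i ω) s :=
  Finset.measurable_fun_sum _ fun _ _ => (Finset.measurable_fun_prod _ fun B _ =>
    measurable_marginalLikelihood hc θstar hYm B).const_mul _

/-- Links prior times expected likelihood of a block to the weight hypothesis of `partitionSum_le`,
by a + 1 ≥ a. -/
theorem factorial_pred_mul_le {a : ℕ} (ha : 0 < a) :
    ((a - 1)! : ℝ) * (2 / ((a : ℝ) + 1)) ≤ 2 * a ! * ((a : ℝ) ^ 2)⁻¹ := by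
  obtain ⟨b, rfl⟩ := Nat.exists_eq_succ_of_ne_zero ha.ne'
  have h1 : 2 * ((b + 1)! : ℝ) * (((b + 1 : ℕ) : ℝ) ^ 2)⁻¹ = b ! * (2 / ((b + 1 : ℕ) : ℝ)) := by
    rw [Nat.factorial_succ]
    push_cast
    field_simp
  rw [Nat.succ_eq_add_one, Nat.add_sub_cancel, h1]
  gcongr
  linarith

theorem lintegral_jointDensity_le [IsProbabilityMeasure P] {π : Measure ℝ} (hπpos : π (Iic 0) = 0)
    {m : ℕ} {c : ℝ} (hc : 0 < c) (θstar : ℝ) {Y : Fin (m + 1) → Ω → ℝ}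
    (hYm : ∀ i, Measurable (Y i)) (hYi : iIndepFun Y P)
    (hY : ∀ i, pdf.IsUniform (Y i) (Ioo (θstar - c) (θstar + c)) P volume) (s : ℕ) :
    ∫⁻ ω, ENNReal.ofReal (jointDensity (fun x θ => unifDensity c θ x) (unifDensity c θstar) π
      (fun i => Y i ω) (s + 1)) ∂P ≤
        ENNReal.ofReal (((2 * c)⁻¹) ^ (m + 1) * priorMoment π m s *
          (16 ^ (s + 1) * (m + 1)! / ((s + 1)! * ((m + 1 : ℕ) : ℝ) ^ 2))) := by
  have hML := marginalLikelihood_nonneg (n := m + 1) c θstar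
  have hM := priorMoment_nonneg hπpos m s
  unfold jointDensity
  simp_rw [ENNReal.ofReal_sum_of_nonneg fun A (_ : A ∈ partitionsInto (m + 1) (s + 1)) =>
    mul_nonneg (partitionProb_nonneg hπpos A) (Finset.prod_nonneg fun B _ => hML _ B),
    ENNReal.ofReal_mul (partitionProb_nonneg hπpos _)]
  have hmeas : ∀ A : Finpartition (Finset.univ : Finset (Fin (m + 1))), Measurable fun ω =>
      ENNReal.ofReal (∏ B ∈ A.parts, marginalLikelihood (fun x θ => unifDensity c θ x)
        (unifDensity c θstar) (fun i => Y i ω) B) := fun A =>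
    ENNReal.measurable_ofReal.comp (Finset.measurable_fun_prod _ fun B _ =>
      measurable_marginalLikelihood hc θstar hYm B)
  rw [lintegral_finsetSum _ fun A _ => (hmeas A).const_mul _]
  simp_rw [lintegral_const_mul _ (hmeas _)]
  calc _ ≤ ∑ A ∈ partitionsInto (m + 1) (s + 1), ENNReal.ofReal (partitionProb π A) *
        ENNReal.ofReal (((2 * c)⁻¹) ^ (m + 1) * ∏ B ∈ A.parts, 2 / ((B.card : ℝ) + 1)) := by
        gcongr with A _
        exact lintegral_prod_marginalLikelihood_le hc θstar hYm hYi hY A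
    _ = ENNReal.ofReal (((2 * c)⁻¹) ^ (m + 1) * priorMoment π m s *
          partitionSum (fun a => ((a - 1)! : ℝ) * (2 / ((a : ℝ) + 1)))
            (Finset.univ : Finset (Fin (m + 1))) (s + 1)) := by
        rw [partitionSum, Finset.mul_sum, ENNReal.ofReal_sum_of_nonneg fun A _ =>
          mul_nonneg (by positivity) (Finset.prod_nonneg fun B _ => by positivity)]
        refine Finset.sum_congr rfl fun A hA => ?_
        rw [← ENNReal.ofReal_mul (partitionProb_nonneg hπpos A),
          partitionProb_eq hπpos A (Finset.mem_filter.1 hA).2, Finset.prod_mul_distrib]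
        congr 1
        ring
    _ ≤ _ := by
        refine ENNReal.ofReal_le_ofReal (mul_le_mul_of_nonneg_left ?_ (by positivity))
        have h := partitionSum_le (ι := Fin (m + 1))
          (w := fun a => ((a - 1)! : ℝ) * (2 / ((a : ℝ) + 1))) (fun a => by positivity)
          (fun a ha => factorial_pred_mul_le ha) s Finset.univ Finset.univ_nonempty
        rwa [Finset.card_univ, Fintype.card_fin] at h

theorem measure_exists_notMem_Ioo_le [IsProbabilityMeasure P] {n : ℕ} {c : ℝ} (hc : 0 < c)
    (θstar : ℝ) {Y : Fin n → Ω → ℝ} (hYm : ∀ i, Measurable (Y i))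
    (hY : ∀ i, pdf.IsUniform (Y i) (Ioo (θstar - c) (θstar + c)) P volume) {δ : ℝ} (hδ : 0 ≤ δ)
    (hδc : δ ≤ c) :
    P {ω | ∃ i, Y i ω ∉ Ioo (θstar - c + δ) (θstar + c - δ)} ≤ ENNReal.ofReal (n * (δ / c)) := by
  have h1 : {ω | ∃ i, Y i ω ∉ Ioo (θstar - c + δ) (θstar + c - δ)} =
      ⋃ i, {ω | Y i ω ∉ Ioo (θstar - c + δ) (θstar + c - δ)} := by
    ext ω
    simp
  rw [h1]
  refine (measure_iUnion_fintype_le _ _).trans (le_of_eq ?_)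
  simp_rw [measure_notMem_Ioo_of_isUniform hc (hYm _) (hY _) hδ hδc]
  rw [Finset.sum_const, Finset.card_univ, Fintype.card_fin, nsmul_eq_mul,
    ENNReal.ofReal_mul (by positivity), ENNReal.ofReal_natCast]

/-- With J the one-cluster term and N the rest, the deviation is N / (N + J); if it is at least η,
then N ≥ η J. -/
theorem le_of_le_abs_posteriorClusters_sub_one {π : Measure ℝ} (hπpos : π (Iic 0) = 0) {m : ℕ}
    (c θstar : ℝ) (x : Fin (m + 1) → ℝ) {η t : ℝ} (ht : 0 < t) (hη : 0 < η)
    (h1 : t ≤ jointDensity (fun x θ => unifDensity c θ x) (unifDensity c θstar) π x 1)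
    (h : η ≤ |posteriorClusters (fun x θ => unifDensity c θ x) (unifDensity c θstar) π x 1 - 1|) :
    η * t ≤ ∑ s ∈ Finset.range m,
      jointDensity (fun x θ => unifDensity c θ x) (unifDensity c θstar) π x (s + 2) := by
  rw [posteriorClusters, Finset.sum_range_succ', Finset.sum_range_succ', jointDensity_zero,
    add_zero, zero_add] at h
  have hN : 0 ≤ ∑ s ∈ Finset.range m,
      jointDensity (fun x θ => unifDensity c θ x) (unifDensity c θstar) π x (s + 1 + 1) :=
    Finset.sum_nonneg fun s _ => jointDensity_nonneg hπpos c θstar x _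
  change η * t ≤ ∑ s ∈ Finset.range m,
      jointDensity (fun x θ => unifDensity c θ x) (unifDensity c θstar) π x (s + 1 + 1)
  generalize ∑ s ∈ Finset.range m, jointDensity (fun x θ => unifDensity c θ x)
    (unifDensity c θstar) π x (s + 1 + 1) = N at h hN
  generalize jointDensity (fun x θ => unifDensity c θ x) (unifDensity c θstar) π x 1 = J at h h1
  have hJ : 0 < J := ht.trans_le h1
  have h2 : J / (N + J) - 1 = -(N / (N + J)) := by
    field_simp
    ring
  rw [h2, abs_neg, abs_of_nonneg (by positivity), le_div_iff₀ (by positivity)] at h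
  nlinarith [mul_le_mul_of_nonneg_left h1 hη.le, mul_nonneg hη.le hN]

theorem measure_le_abs_posteriorClusters_sub_one_le [IsProbabilityMeasure P] {π : Measure ℝ}
    [IsProbabilityMeasure π] (hπpos : π (Iic 0) = 0)
    {m : ℕ} {c : ℝ} (hc : 0 < c) (θstar : ℝ) {Y : Fin (m + 1) → Ω → ℝ}
    (hYm : ∀ i, Measurable (Y i)) (hYi : iIndepFun Y P)
    (hY : ∀ i, pdf.IsUniform (Y i) (Ioo (θstar - c) (θstar + c)) P volume) {η ε : ℝ}
    (hη : 0 < η) (hε : 0 < ε) (hε1 : ε ≤ 1) :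
    P {ω | η ≤ |posteriorClusters (fun x θ => unifDensity c θ x) (unifDensity c θstar) π
      (fun i => Y i ω) 1 - 1|} ≤ ENNReal.ofReal ε + ENNReal.ofReal
        ((∑ s ∈ Finset.range m, 16 ^ (s + 2) / (s + 2)! * priorMoment π m (s + 1)) /
          priorMoment π m 0 * (η * ε)⁻¹) := by
  have hn : (0 : ℝ) < ((m + 1 : ℕ) : ℝ) := by positivity
  have hM0 := priorMoment_zero_pos hπpos m
  -- The margin c ε / n makes the union bound over the n observations equal to ε.
  have hδ : 0 ≤ c * ε / (m + 1 : ℕ) := by positivity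
  have hδc : c * ε / (m + 1 : ℕ) ≤ c := by
    rw [div_le_iff₀ hn]
    push_cast
    have : 0 ≤ (m : ℝ) := m.cast_nonneg
    nlinarith
  have ht : 0 < priorMoment π m 0 * m ! * (((2 * c)⁻¹) ^ (m + 1) * (ε / (m + 1 : ℕ))) := by
    positivity
  set t := priorMoment π m 0 * m ! * (((2 * c)⁻¹) ^ (m + 1) * (ε / (m + 1 : ℕ))) with ht_def
  set N : Ω → ℝ := fun ω => ∑ s ∈ Finset.range m, jointDensity (fun x θ => unifDensity c θ x)
    (unifDensity c θstar) π (fun i => Y i ω) (s + 2) with hN_def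
  have hNm : Measurable N :=
    Finset.measurable_fun_sum _ fun s _ => measurable_jointDensity hc θstar π hYm _
  have hsub : {ω | η ≤ |posteriorClusters (fun x θ => unifDensity c θ x) (unifDensity c θstar) π
      (fun i => Y i ω) 1 - 1|} ⊆
      {ω | ∃ i, Y i ω ∉ Ioo (θstar - c + c * ε / (m + 1 : ℕ))
        (θstar + c - c * ε / (m + 1 : ℕ))} ∪
      {ω | ENNReal.ofReal (η * t) ≤ ENNReal.ofReal (N ω)} := by
    intro ω hω
    by_cases hbad : ∃ i, Y i ω ∉ Ioo (θstar - c + c * ε / (m + 1 : ℕ))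
        (θstar + c - c * ε / (m + 1 : ℕ))
    · exact Or.inl hbad
    · refine Or.inr (ENNReal.ofReal_le_ofReal ?_)
      push Not at hbad
      refine le_of_le_abs_posteriorClusters_sub_one hπpos c θstar _ ht hη ?_ hω
      refine le_trans ?_ (le_jointDensity_one hπpos c θstar _)
      have h1 := le_marginalLikelihood hc θstar hδ hδc (fun i => Y i ω) Finset.univ
        fun i _ => hbad i
      rw [Finset.card_univ, Fintype.card_fin] at h1
      have h2 : c * ε / (m + 1 : ℕ) / c = ε / (m + 1 : ℕ) := by field_simp
      rw [h2] at h1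
      exact mul_le_mul_of_nonneg_left h1 (by positivity)
  refine (measure_mono hsub).trans ((measure_union_le _ _).trans (add_le_add ?_ ?_))
  · refine (measure_exists_notMem_Ioo_le hc θstar hYm hY hδ hδc).trans (le_of_eq ?_)
    congr 1
    field_simp
  · have hpos : 0 < η * t := mul_pos hη ht
    -- Markov's inequality for the terms with at least two clusters.
    refine (meas_ge_le_lintegral_div hNm.ennreal_ofReal.aemeasurable
      (by simpa using hpos) ENNReal.ofReal_ne_top).trans ?_
    rw [ENNReal.div_le_iff (by simpa using hpos) ENNReal.ofReal_ne_top,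
      ← ENNReal.ofReal_mul' hpos.le]
    have hNs : ∀ ω, ENNReal.ofReal (N ω) = ∑ s ∈ Finset.range m, ENNReal.ofReal
        (jointDensity (fun x θ => unifDensity c θ x) (unifDensity c θstar) π
          (fun i => Y i ω) (s + 2)) := fun ω =>
      ENNReal.ofReal_sum_of_nonneg fun s _ => jointDensity_nonneg hπpos c θstar _ _
    simp_rw [hNs]
    rw [lintegral_finsetSum _ fun s _ =>
      (measurable_jointDensity hc θstar π hYm _).ennreal_ofReal]
    refine (Finset.sum_le_sum fun s _ =>
      lintegral_jointDensity_le hπpos hc θstar hYm hYi hY (s + 1)).trans ?_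
    rw [← ENNReal.ofReal_sum_of_nonneg fun s _ => mul_nonneg
      (mul_nonneg (by positivity) (priorMoment_nonneg hπpos _ _)) (by positivity)]
    refine ENNReal.ofReal_le_ofReal (le_of_eq ?_)
    have h3 : ∑ s ∈ Finset.range m, ((2 * c)⁻¹) ^ (m + 1) * priorMoment π m (s + 1) *
        (16 ^ (s + 1 + 1) * (m + 1)! / ((s + 1 + 1)! * ((m + 1 : ℕ) : ℝ) ^ 2)) =
        (∑ s ∈ Finset.range m, 16 ^ (s + 2) / (s + 2)! * priorMoment π m (s + 1)) *
          (((2 * c)⁻¹) ^ (m + 1) * (m + 1)! / ((m + 1 : ℕ) : ℝ) ^ 2) := by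
      rw [Finset.sum_mul]
      refine Finset.sum_congr rfl fun s _ => ?_
      have : (((s + 2)! : ℕ) : ℝ) ≠ 0 := by positivity
      field_simp
    -- Here n! / n² = m! / n cancels against the same factor in t, so no power of n survives.
    rw [h3, ht_def, Nat.factorial_succ]
    generalize ∑ s ∈ Finset.range m, 16 ^ (s + 2) / ((s + 2)! : ℝ) * priorMoment π m (s + 1) = S
    have h4 := hM0.ne'
    generalize priorMoment π m 0 = M at h4
    generalize ((2 * c)⁻¹) ^ (m + 1) = u
    rw [Nat.cast_mul]
    generalize ((m + 1 : ℕ) : ℝ) = n at hn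
    have h5 := hn.ne'
    field_simp

end Posterior

end DPMixture
-- Convergence in probability.
theorem mainTheorem3
    {Ω : Type*} [MeasurableSpace Ω] (P : Measure Ω) [IsProbabilityMeasure P]
    (θstar c : ℝ) (hc : 0 < c)
    -- the data: i.i.d. from `Unif(θ* - c, θ* + c)`
    (X : ℕ → Ω → ℝ) (hXm : ∀ i, Measurable (X i)) (hXindep : iIndepFun X P)
    (hXunif : ∀ i, pdf.IsUniform (X i) (Ioo (θstar - c) (θstar + c)) P volume)
    -- the prior of the concentration parameter: a probability measure on `(0, ∞)`
    (π : Measure ℝ) [IsProbabilityMeasure π] (hπpos : π (Iic 0) = 0)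
    (hA1 : π ≪ volume)
    (hA2 : DPMixture.PolynomialAtOrigin π)
    (ρ : ℝ) (hρ : 38 ≤ ρ) (hA3 : DPMixture.SubfactorialMoments π ρ) :
    TendstoInMeasure P
      (fun (n : ℕ) (ω : Ω) =>
        DPMixture.posteriorClusters
          (fun x θ => DPMixture.unifDensity c θ x) (DPMixture.unifDensity c θstar) π
          (fun i : Fin n => X i ω) 1)
      atTop (fun _ => (1 : ℝ)) := by
  rw [tendstoInMeasure_iff_norm]
  intro η hη
  rw [← tendsto_add_atTop_iff_nat 1, ENNReal.tendsto_nhds_zero]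
  intro e he
  -- The tolerance `e` may be infinite, so a finite r < e is split into halves: one for the boundary
  -- event, one for the Markov bound.
  obtain ⟨r, hr0, hre⟩ := ENNReal.lt_iff_exists_nnreal_btwn.1 he
  have hr : (0 : ℝ) < r := by exact_mod_cast hr0
  have hε : 0 < min 1 ((r : ℝ) / 2) := lt_min one_pos (half_pos hr)
  have hlim := (DPMixture.tendsto_sum_priorMoment_div hπpos hA1 hA2 hρ hA3).mul_const
    (η * min 1 ((r : ℝ) / 2))⁻¹
  rw [zero_mul] at hlim
  filter_upwards [hlim.eventually (gt_mem_nhds (half_pos hr))] with m hm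
  simp only [Real.norm_eq_abs]
  refine (DPMixture.measure_le_abs_posteriorClusters_sub_one_le hπpos hc θstar
    (Y := fun i : Fin (m + 1) => X i) (fun i => hXm i) (hXindep.precomp Fin.val_injective)
    (fun i => hXunif i) hη hε (min_le_left _ _)).trans ?_
  calc _ ≤ ENNReal.ofReal ((r : ℝ) / 2) + ENNReal.ofReal ((r : ℝ) / 2) :=
        add_le_add (ENNReal.ofReal_le_ofReal (min_le_right _ _)) (ENNReal.ofReal_le_ofReal hm.le)
    _ = r := by
        rw [← ENNReal.ofReal_add (half_pos hr).le (half_pos hr).le, add_halves,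
          ENNReal.ofReal_coe_nnreal]
    _ ≤ e := hre.le
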